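/- Let $R_{-2}=(-1,-\tfrac12)\times(-\tfrac12,\tfrac12)$, $R_{-1}=(-\tfrac12,0)\times(-\tfrac12,\tfrac12)$, $R=(-1,0)\times(-\tfrac12,\tfrac12)$ and $\Gamma_D=\partial R_{-2}\setminus\{x: x_1=-\tfrac12\}$. For $M\in\mathbb{R}$ and $u\in W^{1,2}(R;\mathbb{R}^2)$ put $$E_M(u)=\int_{R_{-2}}\big(|\nabla u|^2-M\det\nabla u\big)\,dx+\int_{R_{-1}}|\nabla u|^2\,dx,$$ where $|\cdot|$ is the Frobenius norm, and for $u_0\in W^{1,2}(R;\mathbb{R}^2)$ let $$\mathcal{U}_{u_0}=\{u\in W^{1,2}(R;\mathbb{R}^2): u=u_0 \text{ on } \Gamma_D \text{ in the sense of traces}\}.$$ Let $0<M\le 4$, let $u_0\in W^{1,2}(R;\mathbb{R}^2)$, and let $\psi\in\mathcal{U}_{u_0}$ be a weak solution of the Euler–Lagrange equations of $E_M$, i.e. $\langle E_M'(\psi),u\rangle=\frac{d}{dt}\big|_{t=0}E_M(\psi+tu)=0$ for every $u\in\mathcal{U}_0$. Then $\psi$ is a minimizer of $E_M$ on $\mathcal{U}_{u_0}$,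 that is, $E_M(\psi)\le E_M(v)$ for all $v\in\mathcal{U}_{u_0}$. If $M<4$, it is the only minimizer of $E_M$ on $\mathcal{U}_{u_0}$ (as an element of $W^{1,2}(R;\mathbb{R}^2)$). -/

import Mathlib

open MeasureTheory Filter Topology
open scoped ContDiff

namespace Insulation

/-- The Euclidean plane. -/
abbrev Plane : Type := EuclideanSpace ℝ (Fin 2)

/-- The rectangle `(-1, -1/2) × (-1/2, 1/2)`. -/
def Rm2 : Set Plane := {x | x 0 ∈ Set.Ioo (-1 : ℝ) (-1 / 2) ∧ x 1 ∈ Set.Ioo (-1 / 2 : ℝ) (1 / 2)}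

/-- The rectangle `(-1/2, 0) × (-1/2, 1/2)`. -/
def Rm1 : Set Plane := {x | x 0 ∈ Set.Ioo (-1 / 2 : ℝ) 0 ∧ x 1 ∈ Set.Ioo (-1 / 2 : ℝ) (1 / 2)}

/-- The domain `(-1, 0) × (-1/2, 1/2)`, made of `Rm2`, `Rm1` and their common open edge. -/
def R : Set Plane := {x | x 0 ∈ Set.Ioo (-1 : ℝ) 0 ∧ x 1 ∈ Set.Ioo (-1 / 2 : ℝ) (1 / 2)}

/-- The Dirichlet part of the boundary: `∂Rm2` without its edge on the line `x₁ = -1/2`. -/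
def GammaD : Set Plane := frontier Rm2 \ {x | x 0 = -1 / 2}

/-- `G` is square integrable on `Ω` and is a weak gradient of `u` there, `G x i j = ∂ⱼ uᵢ (x)`. -/
def IsWeakGrad (Ω : Set Plane) (u : Plane → Plane) (G : Plane → Matrix (Fin 2) (Fin 2) ℝ) : Prop :=
  (∀ i j, MemLp (fun x => G x i j) 2 (volume.restrict Ω)) ∧
  ∀ φ : Plane → ℝ, ContDiff ℝ ∞ φ → HasCompactSupport φ → tsupport φ ⊆ Ω →
    ∀ i j, ∫ x in Ω, u x i * fderiv ℝ φ x (EuclideanSpace.single j 1) =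
      - ∫ x in Ω, G x i j * φ x

/-- `u ∈ W^{1,2}(Ω; ℝ²)`; functions are identified when they agree a.e. on `Ω`. -/
def MemW12 (Ω : Set Plane) (u : Plane → Plane) : Prop :=
  (∀ i, MemLp (fun x => u x i) 2 (volume.restrict Ω)) ∧ ∃ G, IsWeakGrad Ω u G

open Classical in
/-- The weak gradient of `u` on `Ω` (determined a.e. on open `Ω`), zero if there is none. -/
noncomputable def weakGrad (Ω : Set Plane) (u : Plane → Plane) :
    Plane → Matrix (Fin 2) (Fin 2) ℝ :=
  if h : ∃ G, IsWeakGrad Ω u G then h.choose else 0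

/-- The trace of `u ∈ W^{1,2}(Ω; ℝ²)` vanishes on `Γ ⊆ ∂Ω`: the trace is the `L²`-limit of the
boundary values of maps smooth up to the boundary that converge to `u` in `W^{1,2}(Ω; ℝ²)`;
here `Γ` carries the one-dimensional Hausdorff measure. -/
def TraceZeroOn (Ω Γ : Set Plane) (u : Plane → Plane) : Prop :=
  ∃ v : ℕ → Plane → Plane,
    (∀ n, ContDiff ℝ ∞ (v n)) ∧
    (∀ i, Tendsto (fun n => eLpNorm (fun x => v n x i - u x i) 2 (volume.restrict Ω))
      atTop (𝓝 0)) ∧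
    (∀ i j, Tendsto (fun n => eLpNorm
      (fun x => fderiv ℝ (v n) x (EuclideanSpace.single j 1) i - weakGrad Ω u x i j) 2
      (volume.restrict Ω)) atTop (𝓝 0)) ∧
    (∀ i, Tendsto (fun n => eLpNorm (fun x => v n x i) 2
      ((Measure.hausdorffMeasure 1).restrict Γ)) atTop (𝓝 0))

/-- The squared Frobenius norm. -/
def frobSq (A : Matrix (Fin 2) (Fin 2) ℝ) : ℝ := ∑ i, ∑ j, A i j ^ 2

/-- `E_M(u) = ∫_{Rm2} (|∇u|² - M det ∇u) dx + ∫_{Rm1} |∇u|² dx`. -/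
noncomputable def energy (M : ℝ) (u : Plane → Plane) : ℝ :=
  (∫ x in Rm2, (frobSq (weakGrad R u x) - M * (weakGrad R u x).det)) +
    ∫ x in Rm1, frobSq (weakGrad R u x)

/-- The admissible class: `u ∈ W^{1,2}(R; ℝ²)` with `u = u₀` on `GammaD` in the sense of traces. -/
def admissible (u₀ : Plane → Plane) : Set (Plane → Plane) :=
  {u | MemW12 R u ∧ TraceZeroOn R GammaD (u - u₀)}

/-- `⟨E_M'(ψ), u⟩ = 0` for all admissible variations `u`, with the Gateaux derivative of `E_M`. -/
def IsWeakSolution (M : ℝ) (ψ : Plane → Plane) : Prop :=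
  ∀ u ∈ admissible 0, HasDerivAt (fun t : ℝ => energy M (ψ + t • u)) 0 0

end Insulation

namespace Insulation

/-! `E_M` is a quadratic functional of the gradient, so at a weak solution the first-order term
drops out: `E_M(ψ + u) = E_M(ψ) + E_M(u)` for every variation `u` with zero trace on `GammaD`.
Everything thus rests on the sign of `E_M(u)`, that is, on the inequality `4 ∫_{Rm2} det ∇u ≤ ∫_R
|∇u|²` (`four_mul_integral_det_le`).

The determinant is a null Lagrangian, seen only through boundary values. Let `ũ` be the reflection
of `u` in the interface `x₁ = -1/2`. On `∂Rm2` either `uᵢ` vanishes (on `GammaD`) or `uₖ - ũₖ` does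
(on the interface), so the Jacobian of the pair `(uᵢ, uₖ - ũₖ)` integrates to zero over `Rm2`
(`integral_jacobian_odd_eq_zero`). Hence `uₖ` may be replaced by `ũₖ`, and `4 ∫ det ∇u` becomes the
integral of `2 (∇u₁ × ∇ũ₂ - ∇u₂ × ∇ũ₁)`, which is pointwise at most `|∇u|² + |∇ũ|²`. The second
summand integrates to the Dirichlet energy on `Rm1`.

It follows that `E_M(u) ≥ (1 - M/4) ∫_R |∇u|²` (`energy_ge`), which gives minimality for `M ≤ 4`.
For `M < 4` a second minimizer differs from `ψ` by a variation with zero gradient and zero trace on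
`GammaD`, and a Poincaré-type identity makes it vanish (`ae_eq_zero_of_weakGrad`). -/

/-- The open box `(a, b) × (c, d)`. -/
def box (a b c d : ℝ) : Set Plane := {x | x 0 ∈ Set.Ioo a b ∧ x 1 ∈ Set.Ioo c d}

/-- The unit coordinate vector. -/
noncomputable abbrev e (j : Fin 2) : Plane := EuclideanSpace.single j 1

/-! ### Boxes: finiteness of measure and integrability of continuous functions -/

theorem isOpen_box (a b c d : ℝ) : IsOpen (box a b c d) :=
  (isOpen_Ioo.preimage (by fun_prop : Continuous fun x : Plane => x 0)).inter
    (isOpen_Ioo.preimage (by fun_prop : Continuous fun x : Plane => x 1))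

theorem measurableSet_box (a b c d : ℝ) : MeasurableSet (box a b c d) :=
  (isOpen_box a b c d).measurableSet

theorem exists_compact_box_subset (a b c d : ℝ) :
    ∃ K : Set Plane, IsCompact K ∧ box a b c d ⊆ K := by
  refine ⟨(fun p : ℝ × ℝ => !₂[p.1, p.2]) '' (Set.Icc a b ×ˢ Set.Icc c d),
    (isCompact_Icc.prod isCompact_Icc).image (by fun_prop), fun x hx => ?_⟩
  refine ⟨(x 0, x 1), ⟨Set.Ioo_subset_Icc_self hx.1, Set.Ioo_subset_Icc_self hx.2⟩, ?_⟩
  ext i; fin_cases i <;> rfl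

instance isFiniteMeasure_box (a b c d : ℝ) :
    IsFiniteMeasure ((volume : Measure Plane).restrict (box a b c d)) := by
  obtain ⟨K, hK, hs⟩ := exists_compact_box_subset a b c d
  exact ⟨by simpa using (measure_mono hs).trans_lt hK.measure_lt_top⟩

theorem memLp_box {f : Plane → ℝ} (hf : Continuous f) (a b c d : ℝ) :
    MemLp f 2 (volume.restrict (box a b c d)) := by
  obtain ⟨K, hK, hs⟩ := exists_compact_box_subset a b c d
  obtain ⟨C, hC⟩ := hK.exists_bound_of_continuousOn hf.continuousOn
  exact MemLp.of_bound hf.aestronglyMeasurable C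
    ((ae_restrict_mem (measurableSet_box a b c d)).mono fun x hx => hC x (hs hx))

theorem integrableOn_box {f : Plane → ℝ} (hf : Continuous f) (a b c d : ℝ) :
    IntegrableOn f (box a b c d) :=
  (memLp_box hf a b c d).integrable (by norm_num)

/-! ### Fubini and the fundamental theorem of calculus on boxes -/

/-- Coordinates identify the plane with `ℝ × ℝ`. -/
noncomputable def coords : Plane ≃ᵐ ℝ × ℝ :=
  (MeasurableEquiv.toLp 2 (Fin 2 → ℝ)).symm.trans MeasurableEquiv.finTwoArrow

theorem coords_apply (x : Plane) : coords x = (x 0, x 1) := rfl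

theorem coords_symm_apply (p : ℝ × ℝ) : coords.symm p = !₂[p.1, p.2] := by
  rw [MeasurableEquiv.symm_apply_eq]; rfl

theorem measurePreserving_coords : MeasurePreserving coords :=
  (volume_preserving_finTwoArrow ℝ).comp
    (EuclideanSpace.volume_preserving_symm_measurableEquiv_toLp (Fin 2))

theorem coords_symm_preimage_box (a b c d : ℝ) :
    coords.symm ⁻¹' box a b c d = Set.Ioo a b ×ˢ Set.Ioo c d := by
  ext p; simp [coords_symm_apply, box]

theorem setIntegral_box {f : Plane → ℝ} (a b c d : ℝ) :
    ∫ x in box a b c d, f x = ∫ p in Set.Ioo a b ×ˢ Set.Ioo c d, f !₂[p.1, p.2] := by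
  rw [← (measurePreserving_coords.symm).setIntegral_preimage_emb
    coords.symm.measurableEmbedding, coords_symm_preimage_box]
  simp only [coords_symm_apply]

theorem integrableOn_prod {f : Plane → ℝ} (hf : Continuous f) (a b c d : ℝ) :
    IntegrableOn (fun p : ℝ × ℝ => f !₂[p.1, p.2]) (Set.Ioo a b ×ˢ Set.Ioo c d) := by
  have h : Continuous (fun p : ℝ × ℝ => f !₂[p.1, p.2]) := by fun_prop
  exact (h.continuousOn.integrableOn_compact (isCompact_Icc.prod isCompact_Icc)).mono_set
    (Set.prod_mono Set.Ioo_subset_Icc_self Set.Ioo_subset_Icc_self)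

theorem setIntegral_box_iterated {f : Plane → ℝ} (hf : Continuous f) {a b c d : ℝ} (hab : a ≤ b)
    (hcd : c ≤ d) : ∫ x in box a b c d, f x = ∫ s in a..b, ∫ t in c..d, f !₂[s, t] := by
  rw [setIntegral_box]
  have := integrableOn_prod hf a b c d
  rw [Measure.volume_eq_prod] at this ⊢
  rw [setIntegral_prod _ this]
  simp only [intervalIntegral.integral_of_le hab, intervalIntegral.integral_of_le hcd,
    integral_Ioc_eq_integral_Ioo]

theorem setIntegral_box_iterated_symm {f : Plane → ℝ} (hf : Continuous f) {a b c d : ℝ}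
    (hab : a ≤ b) (hcd : c ≤ d) :
    ∫ x in box a b c d, f x = ∫ t in c..d, ∫ s in a..b, f !₂[s, t] := by
  rw [setIntegral_box]
  have := integrableOn_prod hf a b c d
  rw [IntegrableOn, Measure.volume_eq_prod, ← Measure.prod_restrict] at this
  rw [Measure.volume_eq_prod, ← Measure.prod_restrict, integral_prod_symm _ this]
  simp only [intervalIntegral.integral_of_le hab, intervalIntegral.integral_of_le hcd,
    integral_Ioc_eq_integral_Ioo]

theorem hasDerivAt_line_fst (s t : ℝ) : HasDerivAt (fun s : ℝ => (!₂[s, t] : Plane)) (e 0) s := by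
  have h : (fun s : ℝ => (!₂[s, t] : Plane)) = fun s => s • e 0 + !₂[0, t] := by
    ext s i; fin_cases i <;> simp
  rw [h]
  simpa using ((hasDerivAt_id s).smul_const (e 0)).add_const (!₂[0, t] : Plane)

theorem hasDerivAt_line_snd (s t : ℝ) : HasDerivAt (fun t : ℝ => (!₂[s, t] : Plane)) (e 1) t := by
  have h : (fun t : ℝ => (!₂[s, t] : Plane)) = fun t => t • e 1 + !₂[s, 0] := by
    ext s i; fin_cases i <;> simp
  rw [h]
  simpa using ((hasDerivAt_id t).smul_const (e 1)).add_const (!₂[s, 0] : Plane)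

theorem integral_box_partial_fst {F : Plane → ℝ} (hF : ContDiff ℝ 1 F) {a b c d : ℝ}
    (hab : a ≤ b) (hcd : c ≤ d) :
    ∫ x in box a b c d, fderiv ℝ F x (e 0) =
      (∫ t in c..d, F !₂[b, t]) - ∫ t in c..d, F !₂[a, t] := by
  have hc := hF.continuous
  have hd : Continuous fun x => fderiv ℝ F x (e 0) :=
    (hF.continuous_fderiv (by norm_num)).clm_apply continuous_const
  rw [setIntegral_box_iterated_symm hd hab hcd, ← intervalIntegral.integral_sub
    (Continuous.intervalIntegrable (by fun_prop) _ _)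
    (Continuous.intervalIntegrable (by fun_prop) _ _)]
  congr 1; ext t
  refine intervalIntegral.integral_eq_sub_of_hasDerivAt (f := fun s => F !₂[s, t])
    (fun s _ => ?_) (Continuous.intervalIntegrable (by fun_prop) _ _)
  exact (hF.differentiable (by norm_num) _).hasFDerivAt.comp_hasDerivAt s (hasDerivAt_line_fst s t)

theorem integral_box_partial_snd {F : Plane → ℝ} (hF : ContDiff ℝ 1 F) {a b c d : ℝ}
    (hab : a ≤ b) (hcd : c ≤ d) :
    ∫ x in box a b c d, fderiv ℝ F x (e 1) =
      (∫ s in a..b, F !₂[s, d]) - ∫ s in a..b, F !₂[s, c] := by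
  have hc := hF.continuous
  have hd : Continuous fun x => fderiv ℝ F x (e 1) :=
    (hF.continuous_fderiv (by norm_num)).clm_apply continuous_const
  rw [setIntegral_box_iterated hd hab hcd, ← intervalIntegral.integral_sub
    (Continuous.intervalIntegrable (by fun_prop) _ _)
    (Continuous.intervalIntegrable (by fun_prop) _ _)]
  congr 1; ext s
  refine intervalIntegral.integral_eq_sub_of_hasDerivAt (f := fun t => F !₂[s, t])
    (fun t _ => ?_) (Continuous.intervalIntegrable (by fun_prop) _ _)
  exact (hF.differentiable (by norm_num) _).hasFDerivAt.comp_hasDerivAt t (hasDerivAt_line_snd s t)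

/-! ### Limits of `L²` pairings -/

/-- Hölder's inequality against a fixed factor. Double limits are later taken one index at a time,
so the second factor never has to move. -/
theorem tendsto_integral_mul {α : Type*} {m : MeasurableSpace α} {μ : Measure α} {f : ℕ → α → ℝ}
    {u g : α → ℝ} (hf : ∀ n, MemLp (f n) 2 μ) (hu : MemLp u 2 μ) (hg : MemLp g 2 μ)
    (h : Tendsto (fun n => eLpNorm (fun x => f n x - u x) 2 μ) atTop (𝓝 0)) :
    Tendsto (fun n => ∫ x, f n x * g x ∂μ) atTop (𝓝 (∫ x, u x * g x ∂μ)) := by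
  have hi : ∀ {k : α → ℝ}, MemLp k 2 μ → Integrable (fun x => k x * g x) μ :=
    fun hk => hk.integrable_mul hg
  refine tendsto_integral_of_L1' (F := fun n x => f n x * g x) _ (hi hu).1
    (.of_forall fun n => hi (hf n)) ?_
  have hlim : Tendsto (fun n => eLpNorm (fun x => f n x - u x) 2 μ * eLpNorm g 2 μ)
      atTop (𝓝 0) := by
    simpa using ENNReal.Tendsto.mul_const h (Or.inr hg.eLpNorm_ne_top)
  refine tendsto_of_tendsto_of_tendsto_of_le_of_le tendsto_const_nhds hlim (fun _ => zero_le)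
    fun n => ?_
  have := eLpNorm_smul_le_mul_eLpNorm (p := 2) (q := 2) (r := 1) hg.1 ((hf n).sub hu).1
  refine le_trans (le_of_eq ?_) this
  congr 1; ext x; simp [sub_mul]

/-! ### Boundary values on the Dirichlet part -/

/-- An isometry carries Lebesgue measure on the line to one-dimensional Hausdorff measure on its
range. This turns the trace condition on `GammaD` into `L²` bounds on each straight edge. -/
theorem eLpNorm_comp_isometry_le {γ : ℝ → Plane} (hγ : Isometry γ) {I : Set ℝ} {Γ : Set Plane}
    (hI : I ⊆ γ ⁻¹' Γ) (f : Plane → ℝ) :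
    eLpNorm (fun t => f (γ t)) 2 (volume.restrict I) ≤
      eLpNorm f 2 ((Measure.hausdorffMeasure 1).restrict Γ) := by
  have hm : MeasurableEmbedding γ := hγ.isClosedEmbedding.measurableEmbedding
  calc eLpNorm (fun t => f (γ t)) 2 (volume.restrict I)
      ≤ eLpNorm (f ∘ γ) 2 (volume.restrict (γ ⁻¹' Γ)) :=
        eLpNorm_mono_measure _ (Measure.restrict_mono hI le_rfl)
    _ = eLpNorm f 2 (Measure.map γ (volume.restrict (γ ⁻¹' Γ))) :=
        (hm.eLpNorm_map_measure).symm
    _ ≤ _ := by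
        refine eLpNorm_mono_measure _ ?_
        rw [← hm.restrict_map, ← hausdorffMeasure_real, hγ.map_hausdorffMeasure (Or.inl zero_le_one)]
        exact Measure.restrict_mono_measure Measure.restrict_le_self _

theorem isometry_line_fst (t : ℝ) : Isometry fun s : ℝ => (!₂[s, t] : Plane) := by
  refine Isometry.of_dist_eq fun x y => ?_
  simp [EuclideanSpace.dist_eq, Real.dist_eq, Real.sqrt_sq_eq_abs]

theorem isometry_line_snd (s : ℝ) : Isometry fun t : ℝ => (!₂[s, t] : Plane) := by
  refine Isometry.of_dist_eq fun x y => ?_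
  simp [EuclideanSpace.dist_eq, Real.dist_eq, Real.sqrt_sq_eq_abs]

theorem tendsto_intervalIntegral_trace {γ : ℝ → Plane} (hγ : Isometry γ) {a b : ℝ} (hab : a ≤ b)
    {Γ : Set Plane} (hI : Set.Ioo a b ⊆ γ ⁻¹' Γ) {f : ℕ → Plane → ℝ} (hf : ∀ n, Continuous (f n))
    (h : Tendsto (fun n => eLpNorm (f n) 2 ((Measure.hausdorffMeasure 1).restrict Γ))
      atTop (𝓝 0)) {g : Plane → ℝ} (hg : Continuous g) :
    Tendsto (fun n => ∫ t in a..b, f n (γ t) * g (γ t)) atTop (𝓝 0) := by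
  have hmem : ∀ {k : Plane → ℝ}, Continuous k →
      MemLp (fun t => k (γ t)) 2 (volume.restrict (Set.Ioo a b)) := fun {k} hk => by
    have hc : Continuous fun t => k (γ t) := hk.comp hγ.continuous
    obtain ⟨C, hC⟩ := (isCompact_Icc (a := a) (b := b)).exists_bound_of_continuousOn hc.continuousOn
    exact MemLp.of_bound hc.aestronglyMeasurable C
      ((ae_restrict_mem measurableSet_Ioo).mono fun x hx => hC x (Set.Ioo_subset_Icc_self hx))
  have := tendsto_integral_mul (fun n => hmem (hf n)) (MemLp.zero' (α := ℝ)) (hmem hg)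
    (tendsto_of_tendsto_of_tendsto_of_le_of_le tendsto_const_nhds h (fun _ => zero_le)
      fun n => by simpa using eLpNorm_comp_isometry_le hγ hI (f n))
  simpa [intervalIntegral.integral_of_le hab, integral_Ioc_eq_integral_Ioo] using this

theorem frontier_box_of_mem {a b c d : ℝ} (hab : a < b) (hcd : c < d) {x : Plane}
    (h0 : x 0 ∈ Set.Icc a b) (h1 : x 1 ∈ Set.Icc c d) (hx : x ∉ box a b c d) :
    x ∈ frontier (box a b c d) := by
  rw [(isOpen_box a b c d).frontier_eq]
  refine ⟨?_, hx⟩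
  have hp : (x 0, x 1) ∈ closure (Set.Ioo a b ×ˢ Set.Ioo c d) := by
    rw [closure_prod_eq, closure_Ioo hab.ne, closure_Ioo hcd.ne]; exact ⟨h0, h1⟩
  have hcont : Continuous fun p : ℝ × ℝ => (!₂[p.1, p.2] : Plane) := by fun_prop
  have := map_mem_closure (t := box a b c d) hcont hp (fun p hp => by simpa [box] using hp)
  convert this using 1
  ext i; fin_cases i <;> rfl

theorem left_mem_GammaD {t : ℝ} (ht : t ∈ Set.Ioo (-1 / 2 : ℝ) (1 / 2)) :
    (!₂[-1, t] : Plane) ∈ GammaD := by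
  refine ⟨frontier_box_of_mem (by norm_num) (by norm_num) ?_ ?_ ?_, ?_⟩
  · simp; norm_num
  · simpa using Set.Ioo_subset_Icc_self ht
  · simp [box]
  · simp; norm_num

theorem bottom_mem_GammaD {s : ℝ} (hs : s ∈ Set.Ioo (-1 : ℝ) (-1 / 2)) :
    (!₂[s, -1 / 2] : Plane) ∈ GammaD := by
  refine ⟨frontier_box_of_mem (by norm_num) (by norm_num) ?_ ?_ ?_, ?_⟩
  · simpa using Set.Ioo_subset_Icc_self hs
  · simp; norm_num
  · simp [box]
  · simpa using hs.2.ne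

theorem top_mem_GammaD {s : ℝ} (hs : s ∈ Set.Ioo (-1 : ℝ) (-1 / 2)) :
    (!₂[s, 1 / 2] : Plane) ∈ GammaD := by
  refine ⟨frontier_box_of_mem (by norm_num) (by norm_num) ?_ ?_ ?_, ?_⟩
  · simpa using Set.Ioo_subset_Icc_self hs
  · simp; norm_num
  · simp [box]
  · simpa using hs.2.ne

/-! ### The Jacobian as a null Lagrangian -/

theorem contDiff_partial {f : Plane → ℝ} (hf : ContDiff ℝ ∞ f) (w : Plane) :
    ContDiff ℝ ∞ fun x => fderiv ℝ f x w :=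
  (hf.fderiv_right (m := ∞) (by simp)).clm_apply contDiff_const

theorem continuous_partial {f : Plane → ℝ} (hf : ContDiff ℝ ∞ f) (w : Plane) :
    Continuous fun x => fderiv ℝ f x w := (contDiff_partial hf w).continuous

theorem fderiv_partial_comm {f : Plane → ℝ} (hf : ContDiff ℝ ∞ f) (x w w' : Plane) :
    fderiv ℝ (fun y => fderiv ℝ f y w) x w' = fderiv ℝ (fun y => fderiv ℝ f y w') x w := by
  have hd : DifferentiableAt ℝ (fderiv ℝ f) x :=
    (hf.fderiv_right (m := ∞) (by simp)).differentiable (by simp) x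
  have h (w w' : Plane) :
      fderiv ℝ (fun y => fderiv ℝ f y w) x w' = fderiv ℝ (fderiv ℝ f) x w' w := by
    rw [fderiv_clm_apply hd (differentiableAt_const w)]
    simp
  rw [h, h]
  exact (hf.contDiffAt.isSymmSndFDerivAt (by simpa using ENat.LEInfty.out)) w' w

theorem fderiv_mul_apply {f g : Plane → ℝ} (hf : ContDiff ℝ ∞ f) (hg : ContDiff ℝ ∞ g)
    (x w : Plane) : fderiv ℝ (fun y => f y * g y) x w =
      fderiv ℝ f x w * g x + f x * fderiv ℝ g x w := by
  rw [fderiv_fun_mul (hf.differentiable (by simp) x) (hg.differentiable (by simp) x)]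
  simp [mul_comm, add_comm]

/-- By symmetry of second derivatives the Jacobian is the divergence-type expression `∂₁(f ∂₂z) -
∂₂(f ∂₁z)`, leaving only edge integrals of `f` times a tangential derivative of `z`. The right edge
contributes nothing since `z` is constant along it. -/
theorem integral_jacobian_box {f z : Plane → ℝ} (hf : ContDiff ℝ ∞ f) (hz : ContDiff ℝ ∞ z)
    {a b c d : ℝ} (hab : a ≤ b) (hcd : c ≤ d) (hz0 : ∀ t, z !₂[b, t] = 0) :
    ∫ x in box a b c d,
        (fderiv ℝ f x (e 0) * fderiv ℝ z x (e 1) - fderiv ℝ f x (e 1) * fderiv ℝ z x (e 0)) =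
      -(∫ t in c..d, f !₂[a, t] * fderiv ℝ z !₂[a, t] (e 1)) -
        ((∫ s in a..b, f !₂[s, d] * fderiv ℝ z !₂[s, d] (e 0)) -
          ∫ s in a..b, f !₂[s, c] * fderiv ℝ z !₂[s, c] (e 0)) := by
  have hF (j) : ContDiff ℝ ∞ fun y => f y * fderiv ℝ z y (e j) := hf.mul (contDiff_partial hz _)
  have h1 := integral_box_partial_fst ((hF 1).of_le (by simp)) hab hcd
  have h2 := integral_box_partial_snd ((hF 0).of_le (by simp)) hab hcd
  have hedge (t : ℝ) : fderiv ℝ z !₂[b, t] (e 1) = 0 := by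
    have := (hz.differentiable (by simp) _).hasFDerivAt.comp_hasDerivAt t (hasDerivAt_line_snd b t)
    have hc : (z ∘ fun t => !₂[b, t]) = fun _ => 0 := by ext t; exact hz0 t
    rw [hc] at this
    exact this.unique (hasDerivAt_const t 0)
  simp only [hedge, mul_zero, intervalIntegral.integral_zero, zero_sub] at h1
  rw [← h1, ← h2, ← integral_sub (integrableOn_box (continuous_partial (hF 1) _) _ _ _ _)
    (integrableOn_box (continuous_partial (hF 0) _) _ _ _ _)]
  congr 1; ext x
  rw [fderiv_mul_apply hf (contDiff_partial hz _), fderiv_mul_apply hf (contDiff_partial hz _),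
    fderiv_partial_comm hz x (e 1) (e 0)]
  ring

/-! ### Reflection in the interface -/

/-- The reflection in the line `x₁ = -1/2`. -/
noncomputable def refl (x : Plane) : Plane := !₂[-1 - x 0, x 1]

theorem refl_line (t : ℝ) : refl !₂[-1 / 2, t] = !₂[-1 / 2, t] := by
  ext i; fin_cases i <;> simp [refl]; norm_num

theorem hasFDerivAt_refl (x : Plane) : HasFDerivAt refl
    (ContinuousLinearMap.id ℝ Plane -
      ((2 : ℝ) • (EuclideanSpace.proj 0 : Plane →L[ℝ] ℝ)).smulRight (e 0)) x := by
  have h : refl = fun x => (ContinuousLinearMap.id ℝ Plane -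
      ((2 : ℝ) • (EuclideanSpace.proj 0 : Plane →L[ℝ] ℝ)).smulRight (e 0)) x + (-1 : ℝ) • e 0 := by
    ext x i; fin_cases i <;> simp [refl]; ring
  rw [h]
  exact (ContinuousLinearMap.hasFDerivAt _).add_const _

theorem contDiff_refl : ContDiff ℝ ∞ refl := by
  rw [contDiff_euclidean]
  intro i
  fin_cases i
  · exact contDiff_const.sub (contDiff_euclidean.1 contDiff_id 0)
  · exact contDiff_euclidean.1 contDiff_id 1

theorem fderiv_comp_refl {g : Plane → ℝ} (hg : ContDiff ℝ ∞ g) (x w : Plane) :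
    fderiv ℝ (fun y => g (refl y)) x w = fderiv ℝ g (refl x) (w - (2 * w 0) • e 0) := by
  have := (hg.differentiable (by simp) (refl x)).hasFDerivAt.comp x (hasFDerivAt_refl x)
  rw [show (fun y => g (refl y)) = g ∘ refl from rfl, this.fderiv]
  simp

theorem measurePreserving_refl : MeasurePreserving refl := by
  have h1 : MeasurePreserving (Prod.map (fun s : ℝ => -1 - s) (id : ℝ → ℝ)) :=
    (Measure.measurePreserving_sub_left volume (-1)).prod (MeasurePreserving.id volume)
  have h2 := (measurePreserving_coords.symm.comp h1).comp measurePreserving_coords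
  convert h2 using 1
  ext x i
  simp [coords_symm_apply, coords_apply, refl]

theorem refl_preimage_Rm1 : refl ⁻¹' Rm1 = Rm2 := by
  ext x
  simp only [Rm1, Rm2, refl, Set.mem_preimage, Set.mem_ofPred_eq, Set.mem_Ioo]
  simp only [Matrix.cons_val_zero, Matrix.cons_val_one]
  constructor <;> rintro ⟨⟨_, _⟩, h⟩ <;> exact ⟨⟨by linarith, by linarith⟩, h⟩

theorem measurePreserving_refl_restrict :
    MeasurePreserving refl (volume.restrict Rm2) (volume.restrict Rm1) := by
  rw [← refl_preimage_Rm1]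
  exact measurePreserving_refl.restrict_preimage (measurableSet_box _ _ _ _)

theorem measurableEmbedding_refl : MeasurableEmbedding refl := by
  have hinv : ∀ x, refl (refl x) = x := fun x => by ext i; fin_cases i <;> simp [refl]
  exact (MeasurableEquiv.mk ⟨refl, refl, hinv, hinv⟩ contDiff_refl.continuous.measurable
    contDiff_refl.continuous.measurable).measurableEmbedding

theorem Rm2_subset_R : Rm2 ⊆ R := fun _ hx => ⟨⟨hx.1.1, by linarith [hx.1.2]⟩, hx.2⟩

theorem Rm1_subset_R : Rm1 ⊆ R := fun _ hx => ⟨⟨by linarith [hx.1.1], hx.1.2⟩, hx.2⟩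

/-- If `f n` has boundary values tending to `0` on `GammaD`, the gradients of `f n` tend to `A` and
those of `g n` tend to `B`, then the Jacobian of `A` against the odd part of `B` integrates to `0`. -/
theorem integral_jacobian_odd_eq_zero {f g : ℕ → Plane → ℝ} {A B : Fin 2 → Plane → ℝ}
    (hf : ∀ n, ContDiff ℝ ∞ (f n)) (hg : ∀ n, ContDiff ℝ ∞ (g n))
    (hA : ∀ j, MemLp (A j) 2 (volume.restrict R)) (hB : ∀ j, MemLp (B j) 2 (volume.restrict R))
    (hfA : ∀ j, Tendsto (fun n => eLpNorm (fun x => fderiv ℝ (f n) x (e j) - A j x) 2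
      (volume.restrict R)) atTop (𝓝 0))
    (hgB : ∀ j, Tendsto (fun n => eLpNorm (fun x => fderiv ℝ (g n) x (e j) - B j x) 2
      (volume.restrict R)) atTop (𝓝 0))
    (htr : Tendsto (fun n => eLpNorm (f n) 2 ((Measure.hausdorffMeasure 1).restrict GammaD))
      atTop (𝓝 0)) :
    (∫ x in Rm2, A 0 x * (B 1 x - B 1 (refl x))) - ∫ x in Rm2, A 1 x * (B 0 x + B 0 (refl x))
      = 0 := by
  have hsub2 : volume.restrict Rm2 ≤ volume.restrict R := Measure.restrict_mono Rm2_subset_R le_rfl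
  have hsub1 : volume.restrict Rm1 ≤ volume.restrict R := Measure.restrict_mono Rm1_subset_R le_rfl
  have hrefl {k : Plane → ℝ} (hk : MemLp k 2 (volume.restrict R)) :
      MemLp (fun x => k (refl x)) 2 (volume.restrict Rm2) :=
    (hk.mono_measure hsub1).comp_measurePreserving measurePreserving_refl_restrict
  have hcont {k : Plane → ℝ} (hk : Continuous k) : MemLp k 2 (volume.restrict Rm2) :=
    memLp_box hk _ _ _ _
  have hcontR {k : Plane → ℝ} (hk : Continuous k) : MemLp k 2 (volume.restrict R) :=
    memLp_box hk _ _ _ _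
  set z : ℕ → Plane → ℝ := fun m x => g m x - g m (refl x) with hzdef
  have hgr (m) : ContDiff ℝ ∞ fun x => g m (refl x) := (hg m).comp contDiff_refl
  have hz (m) : ContDiff ℝ ∞ (z m) := (hg m).sub (hgr m)
  have hzd (m : ℕ) (x w : Plane) : fderiv ℝ (z m) x w =
      fderiv ℝ (g m) x w - fderiv ℝ (g m) (refl x) (w - (2 * w 0) • e 0) := by
    rw [← fderiv_comp_refl (hg m), hzdef]
    simp only
    rw [fderiv_fun_sub ((hg m).differentiable (by simp) x) ((hgr m).differentiable (by simp) x)]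
    rfl
  have hz0 (m x) : fderiv ℝ (z m) x (e 0) =
      fderiv ℝ (g m) x (e 0) + fderiv ℝ (g m) (refl x) (e 0) := by
    rw [hzd, show e 0 - (2 * e 0 0) • e 0 = -e 0 by simp [two_smul], map_neg]; ring
  have hz1 (m x) : fderiv ℝ (z m) x (e 1) =
      fderiv ℝ (g m) x (e 1) - fderiv ℝ (g m) (refl x) (e 1) := by
    rw [hzd, show e 1 - (2 * e 1 0) • e 0 = e 1 by simp]
  -- Here `n → ∞` with `m` fixed: the edge terms pair `f n`, which tends to zero in `L²(GammaD)`,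
  -- with derivatives of `z m`, whose boundary values need not stay bounded as `m` grows. On the
  -- interface `z m` vanishes exactly.
  have hfix (m : ℕ) : (∫ x in Rm2, A 0 x * fderiv ℝ (z m) x (e 1)) -
      ∫ x in Rm2, A 1 x * fderiv ℝ (z m) x (e 0) = 0 := by
    have hlim (j k : Fin 2) : Tendsto
        (fun n => ∫ x in Rm2, fderiv ℝ (f n) x (e j) * fderiv ℝ (z m) x (e k)) atTop
        (𝓝 (∫ x in Rm2, A j x * fderiv ℝ (z m) x (e k))) :=
      tendsto_integral_mul (fun n => hcont (continuous_partial (hf n) _))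
        ((hA j).mono_measure hsub2) (hcont (continuous_partial (hz m) _))
        (tendsto_of_tendsto_of_tendsto_of_le_of_le tendsto_const_nhds (hfA j) (fun _ => zero_le)
          fun n => eLpNorm_mono_measure _ hsub2)
    refine tendsto_nhds_unique ((hlim 0 1).sub (hlim 1 0)) ?_
    have hb1 := tendsto_intervalIntegral_trace (isometry_line_snd (-1))
      (by norm_num : (-1 / 2 : ℝ) ≤ 1 / 2) (fun t ht => left_mem_GammaD ht)
      (fun n => (hf n).continuous) htr (continuous_partial (hz m) (e 1))
    have hb2 := tendsto_intervalIntegral_trace (isometry_line_fst (1 / 2))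
      (by norm_num : (-1 : ℝ) ≤ -1 / 2) (fun t ht => top_mem_GammaD ht)
      (fun n => (hf n).continuous) htr (continuous_partial (hz m) (e 0))
    have hb3 := tendsto_intervalIntegral_trace (isometry_line_fst (-1 / 2))
      (by norm_num : (-1 : ℝ) ≤ -1 / 2) (fun t ht => bottom_mem_GammaD ht)
      (fun n => (hf n).continuous) htr (continuous_partial (hz m) (e 0))
    have hb := hb1.neg.sub (hb2.sub hb3)
    rw [sub_zero, neg_zero, sub_zero] at hb
    refine hb.congr fun n => ?_
    rw [← integral_jacobian_box (hf n) (hz m) (by norm_num) (by norm_num)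
      (fun t => by rw [hzdef]; simp only [refl_line, sub_self])]
    exact integral_sub
      ((hcont (continuous_partial (hf n) _)).integrable_mul (hcont (continuous_partial (hz m) _)))
      ((hcont (continuous_partial (hf n) _)).integrable_mul (hcont (continuous_partial (hz m) _)))
  have hg2 (j) : Tendsto (fun n => eLpNorm (fun x => fderiv ℝ (g n) x (e j) - B j x) 2
      (volume.restrict Rm2)) atTop (𝓝 0) :=
    tendsto_of_tendsto_of_tendsto_of_le_of_le tendsto_const_nhds (hgB j) (fun _ => zero_le)
      fun n => eLpNorm_mono_measure _ hsub2
  have hgm (j n) : MemLp (fun x => fderiv ℝ (g n) x (e j) - B j x) 2 (volume.restrict R) :=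
    (hcontR (continuous_partial (hg n) _)).sub (hB j)
  have hg1 (j) : Tendsto (fun n => eLpNorm (fun x => fderiv ℝ (g n) (refl x) (e j) - B j (refl x)) 2
      (volume.restrict Rm2)) atTop (𝓝 0) := by
    refine tendsto_of_tendsto_of_tendsto_of_le_of_le tendsto_const_nhds (hgB j) (fun _ => zero_le)
      fun n => ?_
    have h := eLpNorm_comp_measurePreserving (p := 2) ((hgm j n).mono_measure hsub1).1
      measurePreserving_refl_restrict
    exact (le_of_eq h).trans (eLpNorm_mono_measure _ hsub1)
  have hadd := (hg2 0).add (hg1 0)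
  have hsub := (hg2 1).add (hg1 1)
  rw [add_zero] at hadd hsub
  have l0 : Tendsto (fun m => eLpNorm (fun x => fderiv ℝ (z m) x (e 0) -
      (B 0 x + B 0 (refl x))) 2 (volume.restrict Rm2)) atTop (𝓝 0) := by
    refine tendsto_of_tendsto_of_tendsto_of_le_of_le tendsto_const_nhds hadd (fun _ => zero_le)
      fun n => ?_
    refine le_trans (le_of_eq ?_) (eLpNorm_add_le ((hgm 0 n).mono_measure hsub2).1
      (hrefl (hgm 0 n)).1 (by norm_num))
    congr 1; ext x; simp only [hz0, Pi.add_apply]; ring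
  have l1 : Tendsto (fun m => eLpNorm (fun x => fderiv ℝ (z m) x (e 1) -
      (B 1 x - B 1 (refl x))) 2 (volume.restrict Rm2)) atTop (𝓝 0) := by
    refine tendsto_of_tendsto_of_tendsto_of_le_of_le tendsto_const_nhds hsub (fun _ => zero_le)
      fun n => ?_
    refine le_trans (le_of_eq ?_) (eLpNorm_sub_le ((hgm 1 n).mono_measure hsub2).1
      (hrefl (hgm 1 n)).1 (by norm_num))
    congr 1; ext x; simp only [hz1, Pi.sub_apply]; ring
  have hA2 (j) := (hA j).mono_measure hsub2
  have hB2 (j) := (hB j).mono_measure hsub2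
  -- With no boundary term left, `m → ∞` needs only the `L²` convergence of `∇(z m)` on `Rm2`.
  have t0 := tendsto_integral_mul (fun m => hcont (continuous_partial (hz m) _))
    ((hB2 0).add (hrefl (hB 0))) (hA2 1) l0
  have t1 := tendsto_integral_mul (fun m => hcont (continuous_partial (hz m) _))
    ((hB2 1).sub (hrefl (hB 1))) (hA2 0) l1
  have t := t1.sub t0
  simp only [mul_comm _ (A _ _), hfix] at t
  exact (tendsto_nhds_unique t tendsto_const_nhds)

/-! ### Linearity of the weak gradient -/

theorem MemW12.isWeakGrad {Ω : Set Plane} {u : Plane → Plane} (hu : MemW12 Ω u) :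
    IsWeakGrad Ω u (weakGrad Ω u) := by
  rw [weakGrad, dif_pos hu.2]; exact hu.2.choose_spec

theorem memLp_restrict_of_hasCompactSupport {φ : Plane → ℝ} (hφ : Continuous φ)
    (hc : HasCompactSupport φ) (Ω : Set Plane) : MemLp φ 2 (volume.restrict Ω) :=
  (hφ.memLp_of_hasCompactSupport hc).restrict Ω

/-- The fundamental lemma of the calculus of variations. `weakGrad` is a choice among weak
gradients, so this is what makes it linear almost everywhere. -/
theorem IsWeakGrad.ae_eq {Ω : Set Plane} (hΩ : IsOpen Ω) {u : Plane → Plane}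
    {G H : Plane → Matrix (Fin 2) (Fin 2) ℝ} (hG : IsWeakGrad Ω u G) (hH : IsWeakGrad Ω u H) :
    G =ᵐ[volume.restrict Ω] H := by
  have key (i j : Fin 2) : ∀ᵐ x ∂volume.restrict Ω, G x i j - H x i j = 0 := by
    rw [ae_restrict_iff' hΩ.measurableSet]
    have hm : MemLp (fun x => G x i j - H x i j) 2 (volume.restrict Ω) := (hG.1 i j).sub (hH.1 i j)
    refine hΩ.ae_eq_zero_of_integral_contDiff_smul_eq_zero ?_ fun φ hφ hc hs => ?_
    · intro x hx
      obtain ⟨r, hr, hb⟩ := Metric.isOpen_iff.1 hΩ x hx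
      refine ⟨Metric.ball x r, mem_nhdsWithin_of_mem_nhds (Metric.ball_mem_nhds x hr), ?_⟩
      have : IsFiniteMeasure ((volume : Measure Plane).restrict (Metric.ball x r)) :=
        ⟨by simpa using measure_ball_lt_top (μ := volume) (x := x) (r := r)⟩
      exact (hm.mono_measure (Measure.restrict_mono hb le_rfl)).integrable (by norm_num)
    · have hφm := memLp_restrict_of_hasCompactSupport hφ.continuous hc Ω
      have h := (hG.2 φ hφ hc hs i j).symm.trans (hH.2 φ hφ hc hs i j)
      rw [← setIntegral_eq_integral_of_forall_compl_eq_zero (s := Ω) fun x hx => by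
        rw [image_eq_zero_of_notMem_tsupport fun h => hx (hs h), zero_smul]]
      have h' := integral_sub ((hG.1 i j).integrable_mul hφm) ((hH.1 i j).integrable_mul hφm)
      simp only [Pi.mul_apply] at h'
      rw [neg_inj.1 h, sub_self] at h'
      rw [← h']
      congr 1; ext x; simp only [smul_eq_mul]; ring
  filter_upwards [key 0 0, key 0 1, key 1 0, key 1 1] with x h1 h2 h3 h4
  ext i j
  fin_cases i <;> fin_cases j <;> exact sub_eq_zero.1 (by assumption)

theorem IsWeakGrad.add_smul {Ω : Set Plane} {u v : Plane → Plane}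
    {G H : Plane → Matrix (Fin 2) (Fin 2) ℝ} (hu : ∀ i, MemLp (fun x => u x i) 2 (volume.restrict Ω))
    (hv : ∀ i, MemLp (fun x => v x i) 2 (volume.restrict Ω))
    (hG : IsWeakGrad Ω u G) (hH : IsWeakGrad Ω v H) (t : ℝ) :
    IsWeakGrad Ω (u + t • v) (fun x => G x + t • H x) := by
  refine ⟨fun i j => by simpa using! (hG.1 i j).add ((hH.1 i j).const_mul t), ?_⟩
  intro φ hφ hc hs i j
  have hφm := memLp_restrict_of_hasCompactSupport hφ.continuous hc Ω
  have hdm : MemLp (fun x => fderiv ℝ φ x (EuclideanSpace.single j 1)) 2 (volume.restrict Ω) :=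
    memLp_restrict_of_hasCompactSupport (continuous_partial hφ _) (hc.fderiv_apply ℝ _) Ω
  have h1 := integral_add ((hu i).integrable_mul hdm) (((hv i).integrable_mul hdm).const_mul t)
  have h2 := integral_add ((hG.1 i j).integrable_mul hφm)
    (((hH.1 i j).integrable_mul hφm).const_mul t)
  rw [integral_const_mul] at h1 h2
  simp only [Pi.mul_apply] at h1 h2
  rw [hG.2 φ hφ hc hs i j, hH.2 φ hφ hc hs i j] at h1
  have e1 (x : Plane) : (u + t • v) x i * fderiv ℝ φ x (EuclideanSpace.single j 1) =
      u x i * fderiv ℝ φ x (EuclideanSpace.single j 1) +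
        t * (v x i * fderiv ℝ φ x (EuclideanSpace.single j 1)) := by simp; ring
  have e2 (x : Plane) : (G x + t • H x) i j * φ x = G x i j * φ x + t * (H x i j * φ x) := by
    simp; ring
  simp only [e1, e2]
  rw [h1, h2]; ring

theorem MemW12.add_smul {Ω : Set Plane} {u v : Plane → Plane} (hu : MemW12 Ω u) (hv : MemW12 Ω v)
    (t : ℝ) : MemW12 Ω (u + t • v) :=
  ⟨fun i => by simpa using! (hu.1 i).add ((hv.1 i).const_mul t),
    _, hu.isWeakGrad.add_smul hu.1 hv.1 hv.isWeakGrad t⟩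

theorem weakGrad_add_smul {Ω : Set Plane} (hΩ : IsOpen Ω) {u v : Plane → Plane} (hu : MemW12 Ω u)
    (hv : MemW12 Ω v) (t : ℝ) : weakGrad Ω (u + t • v) =ᵐ[volume.restrict Ω]
      fun x => weakGrad Ω u x + t • weakGrad Ω v x :=
  (hu.add_smul hv t).isWeakGrad.ae_eq hΩ (hu.isWeakGrad.add_smul hu.1 hv.1 hv.isWeakGrad t)

theorem MemW12.sub {Ω : Set Plane} {u v : Plane → Plane} (hu : MemW12 Ω u) (hv : MemW12 Ω v) :
    MemW12 Ω (u - v) := by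
  simpa [sub_eq_add_neg] using hu.add_smul hv (-1)

theorem weakGrad_sub {Ω : Set Plane} (hΩ : IsOpen Ω) {u v : Plane → Plane} (hu : MemW12 Ω u)
    (hv : MemW12 Ω v) : weakGrad Ω (u - v) =ᵐ[volume.restrict Ω]
      fun x => weakGrad Ω u x - weakGrad Ω v x := by
  simpa [sub_eq_add_neg] using weakGrad_add_smul hΩ hu hv (-1)

theorem isOpen_R : IsOpen R := isOpen_box _ _ _ _

/-- The difference of the sequences approximating `v - u₀` and `u - u₀` approximates `v - u`, and
its boundary values tend to zero by the triangle inequality. -/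
theorem sub_mem_admissible_zero {u₀ u v : Plane → Plane} (hu₀ : MemW12 R u₀)
    (hu : u ∈ admissible u₀) (hv : v ∈ admissible u₀) : v - u ∈ admissible 0 := by
  obtain ⟨hu, a, ha, hau, hag, hat⟩ := hu
  obtain ⟨hv, b, hb, hbu, hbg, hbt⟩ := hv
  have hw := weakGrad_sub isOpen_R (hv.sub hu₀) (hu.sub hu₀)
  rw [sub_sub_sub_cancel_right] at hw
  have hsq {α : Type} {m : MeasurableSpace α} {μ : Measure α} {p q : ℕ → α → ℝ} {r : ℕ → α → ℝ}
      (hp : ∀ n, AEStronglyMeasurable (p n) μ) (hq : ∀ n, AEStronglyMeasurable (q n) μ)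
      (hr : ∀ n, r n =ᵐ[μ] fun x => p n x - q n x)
      (tp : Tendsto (fun n => eLpNorm (p n) 2 μ) atTop (𝓝 0))
      (tq : Tendsto (fun n => eLpNorm (q n) 2 μ) atTop (𝓝 0)) :
      Tendsto (fun n => eLpNorm (r n) 2 μ) atTop (𝓝 0) := by
    have ht := tp.add tq
    rw [add_zero] at ht
    refine tendsto_of_tendsto_of_tendsto_of_le_of_le tendsto_const_nhds ht (fun _ => zero_le)
      fun n => ?_
    exact (eLpNorm_congr_ae (hr n)).trans_le (eLpNorm_sub_le (hp n) (hq n) (by norm_num))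
  have hcomp {f : ℕ → Plane → Plane} (hf : ∀ n, ContDiff ℝ ∞ (f n)) (n : ℕ) (i : Fin 2) :
      Continuous fun x => f n x i := (contDiff_euclidean.1 (hf n) i).continuous
  have hder {f : ℕ → Plane → Plane} (hf : ∀ n, ContDiff ℝ ∞ (f n)) (n : ℕ) (i j : Fin 2) :
      Continuous fun x => fderiv ℝ (f n) x (EuclideanSpace.single j 1) i := by
    have := ((hf n).continuous_fderiv (by simp)).clm_apply
      (continuous_const (y := EuclideanSpace.single j (1 : ℝ)))
    fun_prop
  refine ⟨hv.sub hu, fun n => b n - a n, fun n => (hb n).sub (ha n), ?_, ?_, ?_⟩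
  · intro i
    refine hsq (fun n => ((hcomp hb n i).aestronglyMeasurable.sub ((hv.sub hu₀).1 i).1))
      (fun n => ((hcomp ha n i).aestronglyMeasurable.sub ((hu.sub hu₀).1 i).1)) (fun n => ?_)
      (hbu i) (hau i)
    refine .of_forall fun x => ?_
    simp; ring
  · intro i j
    refine hsq
      (fun n => ((hder hb n i j).aestronglyMeasurable.sub ((hv.sub hu₀).isWeakGrad.1 i j).1))
      (fun n => ((hder ha n i j).aestronglyMeasurable.sub ((hu.sub hu₀).isWeakGrad.1 i j).1))
      (fun n => ?_) (hbg i j) (hag i j)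
    filter_upwards [hw] with x hx
    rw [sub_zero, hx, fderiv_sub ((hb n).differentiable (by simp) x)
      ((ha n).differentiable (by simp) x)]
    simp; ring
  · intro i
    exact hsq (fun n => (hcomp hb n i).aestronglyMeasurable)
      (fun n => (hcomp ha n i).aestronglyMeasurable) (fun n => .of_forall fun x => by simp)
      (hbt i) (hat i)

/-! ### The energy as a quadratic functional -/

/-- The energy of a matrix field. -/
noncomputable def gradEnergy (M : ℝ) (G : Plane → Matrix (Fin 2) (Fin 2) ℝ) : ℝ :=
  (∫ x in Rm2, (frobSq (G x) - M * (G x).det)) + ∫ x in Rm1, frobSq (G x)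

theorem gradEnergy_congr (M : ℝ) {G H : Plane → Matrix (Fin 2) (Fin 2) ℝ}
    (h : G =ᵐ[volume.restrict R] H) : gradEnergy M G = gradEnergy M H := by
  have h2 := ae_restrict_of_ae_restrict_of_subset Rm2_subset_R h
  have h1 := ae_restrict_of_ae_restrict_of_subset Rm1_subset_R h
  rw [gradEnergy, gradEnergy]
  congr 1
  · exact integral_congr_ae (h2.mono fun x hx => by simp only [hx])
  · exact integral_congr_ae (h1.mono fun x hx => by simp only [hx])

/-- The polar form of `frobSq - M det`. -/
def polarForm (M : ℝ) (A B : Matrix (Fin 2) (Fin 2) ℝ) : ℝ :=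
  2 * (∑ i, ∑ j, A i j * B i j) -
    M * (A 0 0 * B 1 1 + A 1 1 * B 0 0 - A 0 1 * B 1 0 - A 1 0 * B 0 1)

theorem frobSq_add_smul (M : ℝ) (A B : Matrix (Fin 2) (Fin 2) ℝ) (t : ℝ) :
    frobSq (A + t • B) - M * (A + t • B).det =
      (frobSq A - M * A.det) + t * polarForm M A B + t ^ 2 * (frobSq B - M * B.det) := by
  simp only [frobSq, polarForm, Fin.sum_univ_two, Matrix.det_fin_two, Matrix.add_apply,
    Matrix.smul_apply, smul_eq_mul]
  ring

variable {μ : Measure Plane} {G H : Plane → Matrix (Fin 2) (Fin 2) ℝ}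

theorem integrable_entry_mul (hG : ∀ i j, MemLp (fun x => G x i j) 2 μ)
    (hH : ∀ i j, MemLp (fun x => H x i j) 2 μ) (i j k l : Fin 2) :
    Integrable (fun x => G x i j * H x k l) μ := (hG i j).integrable_mul (hH k l)

theorem integrable_frobSq (hG : ∀ i j, MemLp (fun x => G x i j) 2 μ) :
    Integrable (fun x => frobSq (G x)) μ :=
  integrable_finsetSum _ fun i _ => integrable_finsetSum _ fun j _ => (hG i j).integrable_sq

theorem integrable_det (hG : ∀ i j, MemLp (fun x => G x i j) 2 μ) :
    Integrable (fun x => (G x).det) μ := by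
  simp only [Matrix.det_fin_two]
  exact (integrable_entry_mul hG hG 0 0 1 1).sub (integrable_entry_mul hG hG 0 1 1 0)

theorem integrable_polarForm (M : ℝ) (hG : ∀ i j, MemLp (fun x => G x i j) 2 μ)
    (hH : ∀ i j, MemLp (fun x => H x i j) 2 μ) :
    Integrable (fun x => polarForm M (G x) (H x)) μ := by
  have h := integrable_entry_mul hG hH
  refine ((integrable_finsetSum _ fun i _ => integrable_finsetSum _ fun j _ =>
    h i j i j).const_mul 2).sub (Integrable.const_mul ?_ M)
  exact (((h 0 0 1 1).add (h 1 1 0 0)).sub (h 0 1 1 0)).sub (h 1 0 0 1)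

theorem integral_quadratic_add_smul (M : ℝ) (hG : ∀ i j, MemLp (fun x => G x i j) 2 μ)
    (hH : ∀ i j, MemLp (fun x => H x i j) 2 μ) (t : ℝ) :
    ∫ x, (frobSq (G x + t • H x) - M * (G x + t • H x).det) ∂μ =
      ∫ x, (frobSq (G x) - M * (G x).det) ∂μ + t * ∫ x, polarForm M (G x) (H x) ∂μ +
        t ^ 2 * ∫ x, (frobSq (H x) - M * (H x).det) ∂μ := by
  simp only [frobSq_add_smul]
  have h1 := (integrable_frobSq hG).sub ((integrable_det hG).const_mul M)
  have h2 := (integrable_frobSq hH).sub ((integrable_det hH).const_mul M)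
  have h3 := integrable_polarForm M hG hH
  rw [integral_add (by exact h1.add (h3.const_mul t)) (by exact h2.const_mul _),
    integral_add (by exact h1) (by exact h3.const_mul t), integral_const_mul, integral_const_mul]

theorem exists_gradEnergy_add_smul (M : ℝ)
    (hG : ∀ i j, MemLp (fun x => G x i j) 2 (volume.restrict R))
    (hH : ∀ i j, MemLp (fun x => H x i j) 2 (volume.restrict R)) :
    ∃ b : ℝ, ∀ t : ℝ, gradEnergy M (fun x => G x + t • H x) =
      gradEnergy M G + t * b + t ^ 2 * gradEnergy M H := by
  have hsub2 : volume.restrict Rm2 ≤ volume.restrict R := Measure.restrict_mono Rm2_subset_R le_rfl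
  have hsub1 : volume.restrict Rm1 ≤ volume.restrict R := Measure.restrict_mono Rm1_subset_R le_rfl
  refine ⟨(∫ x in Rm2, polarForm M (G x) (H x)) + ∫ x in Rm1, polarForm 0 (G x) (H x),
    fun t => ?_⟩
  have h2 := integral_quadratic_add_smul M (fun i j => (hG i j).mono_measure hsub2)
    (fun i j => (hH i j).mono_measure hsub2) t
  -- On `Rm1` the density is the case `M = 0`.
  have h1 := integral_quadratic_add_smul 0 (fun i j => (hG i j).mono_measure hsub1)
    (fun i j => (hH i j).mono_measure hsub1) t
  simp only [zero_mul, sub_zero] at h1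
  simp only [gradEnergy]
  rw [h1, h2]
  ring

theorem energy_eq_add_of_isWeakSolution {M : ℝ} {ψ u : Plane → Plane} (hψ : MemW12 R ψ)
    (hEL : IsWeakSolution M ψ) (hu : u ∈ admissible 0) :
    energy M (ψ + u) = energy M ψ + energy M u := by
  obtain ⟨b, hb⟩ := exists_gradEnergy_add_smul M hψ.isWeakGrad.1 hu.1.isWeakGrad.1
  have hE (t : ℝ) : energy M (ψ + t • u) = energy M ψ + t * b + t ^ 2 * energy M u :=
    (gradEnergy_congr M (weakGrad_add_smul isOpen_R hψ hu.1 t)).trans (hb t)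
  have hd := hEL u hu
  simp only [hE] at hd
  have hd' : HasDerivAt (fun t : ℝ => energy M ψ + t * b + t ^ 2 * energy M u) b 0 := by
    simpa using! (((hasDerivAt_id (0 : ℝ)).mul_const b).const_add (energy M ψ)).add
      (((hasDerivAt_id (0 : ℝ)).pow 2).mul_const (energy M u))
  have h1 := hE 1
  -- The derivative at `0` of the quadratic polynomial in `t` is `b`, so the weak equation says `b =
  -- 0`; evaluating at `t = 1` gives the splitting.
  rw [hd'.unique hd] at h1
  simpa using h1

/-! ### Coercivity on variations -/

/-- The smooth approximations of the components of an admissible variation. -/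
theorem exists_components {u : Plane → Plane} (hu : u ∈ admissible 0) :
    ∃ f : Fin 2 → ℕ → Plane → ℝ, (∀ i n, ContDiff ℝ ∞ (f i n)) ∧
      (∀ i, Tendsto (fun n => eLpNorm (fun x => f i n x - u x i) 2 (volume.restrict R))
        atTop (𝓝 0)) ∧
      (∀ i j, Tendsto (fun n => eLpNorm (fun x => fderiv ℝ (f i n) x (e j) - weakGrad R u x i j) 2
        (volume.restrict R)) atTop (𝓝 0)) ∧
      ∀ i, Tendsto (fun n => eLpNorm (f i n) 2 ((Measure.hausdorffMeasure 1).restrict GammaD))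
        atTop (𝓝 0) := by
  obtain ⟨-, v, hv, h1, h2, h3⟩ := hu
  rw [sub_zero] at h1 h2
  refine ⟨fun i n x => v n x i, fun i n => contDiff_euclidean.1 (hv n) i, h1, fun i j => ?_, h3⟩
  refine (h2 i j).congr fun n => ?_
  congr 1; ext x
  have := ((EuclideanSpace.proj i : Plane →L[ℝ] ℝ).hasFDerivAt.comp x
    ((hv n).differentiable (by simp) x).hasFDerivAt).fderiv
  exact congrArg (· - _) (congrArg (· (e j)) this).symm

/-- The determinant is traded for mixed products of `∇u` and the reflected gradient, which the two
Dirichlet energies control. -/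
theorem four_mul_integral_det_le {u : Plane → Plane} (hu : u ∈ admissible 0) :
    4 * ∫ x in Rm2, (weakGrad R u x).det ≤
      (∫ x in Rm2, frobSq (weakGrad R u x)) + ∫ x in Rm1, frobSq (weakGrad R u x) := by
  obtain ⟨f, hf, -, hfG, htr⟩ := exists_components hu
  have hG := hu.1.isWeakGrad.1
  set G := weakGrad R u
  have h01 := integral_jacobian_odd_eq_zero (hf 0) (hf 1) (hG 0) (hG 1) (hfG 0) (hfG 1) (htr 0)
  have h10 := integral_jacobian_odd_eq_zero (hf 1) (hf 0) (hG 1) (hG 0) (hfG 1) (hfG 0) (htr 1)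
  have hG2 (i j) : MemLp (fun x => G x i j) 2 (volume.restrict Rm2) :=
    (hG i j).mono_measure (Measure.restrict_mono Rm2_subset_R le_rfl)
  have hG1 (i j) : MemLp (fun x => G x i j) 2 (volume.restrict Rm1) :=
    (hG i j).mono_measure (Measure.restrict_mono Rm1_subset_R le_rfl)
  have hGr (i j) : MemLp (fun x => G (refl x) i j) 2 (volume.restrict Rm2) :=
    (hG1 i j).comp_measurePreserving measurePreserving_refl_restrict
  have hrefl : ∫ x in Rm1, frobSq (G x) = ∫ x in Rm2, frobSq (G (refl x)) :=
    (measurePreserving_refl_restrict.integral_comp measurableEmbedding_refl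
      fun x => frobSq (G x)).symm
  have i1 (i j k l : Fin 2) :
      Integrable (fun x => G x i j * (G x k l - G (refl x) k l)) (volume.restrict Rm2) :=
    (hG2 i j).integrable_mul ((hG2 k l).sub (hGr k l))
  have i2 (i j k l : Fin 2) :
      Integrable (fun x => G x i j * (G x k l + G (refl x) k l)) (volume.restrict Rm2) :=
    (hG2 i j).integrable_mul ((hG2 k l).add (hGr k l))
  rw [← integral_sub (i1 _ _ _ _) (i2 _ _ _ _)] at h01 h10
  have j01 := (i1 0 0 1 1).sub (i2 0 1 1 0)
  have j10 := (i1 1 0 0 1).sub (i2 1 1 0 0)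
  have hdet := (integrable_det hG2).const_mul 4
  have hfr := (integrable_frobSq hG2).add (integrable_frobSq hGr)
  -- The terms with coefficients `-2` and `+2` integrate to zero by `h01` and `h10`; pointwise they
  -- cancel `4 det` and leave only products of an entry of `G x` with an entry of `G (refl x)`.
  have key : ∫ x in Rm2, (4 * (G x).det -
      2 * ((G x 0 0 * (G x 1 1 - G (refl x) 1 1)) - (G x 0 1 * (G x 1 0 + G (refl x) 1 0))) +
      2 * ((G x 1 0 * (G x 0 1 - G (refl x) 0 1)) - (G x 1 1 * (G x 0 0 + G (refl x) 0 0)))) ≤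
      ∫ x in Rm2, (frobSq (G x) + frobSq (G (refl x))) := by
    refine integral_mono (by exact (hdet.sub (j01.const_mul 2)).add (j10.const_mul 2))
      (by exact hfr) fun x => ?_
    simp only [frobSq, Fin.sum_univ_two, Matrix.det_fin_two]
    -- The right side minus the left side is exactly the sum of these four squares.
    nlinarith [sq_nonneg (G x 0 0 - G (refl x) 1 1), sq_nonneg (G x 0 1 - G (refl x) 1 0),
      sq_nonneg (G x 1 0 + G (refl x) 0 1), sq_nonneg (G x 1 1 + G (refl x) 0 0)]
  rw [integral_add (by exact hdet.sub (j01.const_mul 2)) (by exact j10.const_mul 2),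
    integral_sub (by exact hdet) (by exact j01.const_mul 2), integral_const_mul, integral_const_mul,
    integral_const_mul, h01, h10,
    integral_add (by exact integrable_frobSq hG2) (by exact integrable_frobSq hGr)] at key
  rw [hrefl]
  linarith

theorem energy_ge {M : ℝ} (hM : 0 ≤ M) {u : Plane → Plane} (hu : u ∈ admissible 0) :
    (1 - M / 4) * ((∫ x in Rm2, frobSq (weakGrad R u x)) + ∫ x in Rm1, frobSq (weakGrad R u x)) ≤
      energy M u := by
  have hG2 (i j) : MemLp (fun x => weakGrad R u x i j) 2 (volume.restrict Rm2) :=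
    (hu.1.isWeakGrad.1 i j).mono_measure (Measure.restrict_mono Rm2_subset_R le_rfl)
  have h := four_mul_integral_det_le hu
  rw [energy, integral_sub (integrable_frobSq hG2) ((integrable_det hG2).const_mul M),
    integral_const_mul]
  nlinarith [mul_le_mul_of_nonneg_left h hM]

theorem frobSq_nonneg (A : Matrix (Fin 2) (Fin 2) ℝ) : 0 ≤ frobSq A :=
  Finset.sum_nonneg fun _ _ => Finset.sum_nonneg fun _ _ => sq_nonneg _

theorem energy_nonneg {M : ℝ} (hM0 : 0 ≤ M) (hM4 : M ≤ 4) {u : Plane → Plane}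
    (hu : u ∈ admissible 0) : 0 ≤ energy M u :=
  (mul_nonneg (by linarith) (add_nonneg (integral_nonneg fun _ => frobSq_nonneg _)
    (integral_nonneg fun _ => frobSq_nonneg _))).trans (energy_ge hM0 hu)

/-! ### Uniqueness -/

theorem entry_eq_zero_of_frobSq {A : Matrix (Fin 2) (Fin 2) ℝ} (h : frobSq A = 0) (i j : Fin 2) :
    A i j = 0 := by
  have h1 := (Finset.sum_eq_zero_iff_of_nonneg fun i _ =>
    Finset.sum_nonneg fun j _ => sq_nonneg (A i j)).1 h i (Finset.mem_univ i)
  exact pow_eq_zero_iff two_ne_zero |>.1 <|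
    (Finset.sum_eq_zero_iff_of_nonneg fun j _ => sq_nonneg (A i j)).1 h1 j (Finset.mem_univ j)

/-- The common edge of `Rm2` and `Rm1` is a null set. -/
theorem ae_mem_union : ∀ᵐ x ∂volume.restrict R, x ∈ Rm2 ∪ Rm1 := by
  have h0 : ∀ᵐ x : Plane, x 0 ≠ -1 / 2 := by
    have h1 : ∀ᵐ p : ℝ × ℝ, p.1 ≠ -1 / 2 :=
      (Measure.quasiMeasurePreserving_fst (μ := volume) (ν := volume)).ae
        (Measure.ae_ne volume (-1 / 2 : ℝ))
    exact measurePreserving_coords.quasiMeasurePreserving.ae h1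
  filter_upwards [ae_restrict_of_ae h0, ae_restrict_mem isOpen_R.measurableSet] with x hx hR
  rcases lt_or_gt_of_ne hx with h | h
  · exact Or.inl ⟨⟨hR.1.1, h⟩, hR.2⟩
  · exact Or.inr ⟨⟨h, hR.1.2⟩, hR.2⟩

theorem weakGrad_ae_eq_zero {M : ℝ} (hM0 : 0 ≤ M) (hM4 : M < 4) {u : Plane → Plane}
    (hu : u ∈ admissible 0) (hE : energy M u ≤ 0) :
    ∀ᵐ x ∂volume.restrict R, ∀ i j, weakGrad R u x i j = 0 := by
  have hG2 := integrable_frobSq fun i j => (hu.1.isWeakGrad.1 i j).mono_measure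
    (Measure.restrict_mono Rm2_subset_R le_rfl)
  have hG1 := integrable_frobSq fun i j => (hu.1.isWeakGrad.1 i j).mono_measure
    (Measure.restrict_mono Rm1_subset_R le_rfl)
  have h := (energy_ge hM0 hu).trans hE
  have n2 : 0 ≤ ∫ x in Rm2, frobSq (weakGrad R u x) := integral_nonneg fun _ => frobSq_nonneg _
  have n1 : 0 ≤ ∫ x in Rm1, frobSq (weakGrad R u x) := integral_nonneg fun _ => frobSq_nonneg _
  have hs := nonpos_of_mul_nonpos_right h (by linarith)
  have z2 := (integral_eq_zero_iff_of_nonneg (fun _ => frobSq_nonneg _) hG2).1 (by linarith)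
  have z1 := (integral_eq_zero_iff_of_nonneg (fun _ => frobSq_nonneg _) hG1).1 (by linarith)
  have z2' := (ae_restrict_iff' (measurableSet_box _ _ _ _ : MeasurableSet Rm2)).1 z2
  have z1' := (ae_restrict_iff' (measurableSet_box _ _ _ _ : MeasurableSet Rm1)).1 z1
  filter_upwards [ae_mem_union, ae_restrict_of_ae z2', ae_restrict_of_ae z1'] with x hx h2 h1 i j
  exact entry_eq_zero_of_frobSq (hx.elim h2 h1) i j

/-- A Poincaré argument in the first variable, using only the left edge of `R`. -/
theorem ae_eq_zero_of_weakGrad {u : Plane → Plane} (hu : u ∈ admissible 0)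
    (hG : ∀ᵐ x ∂volume.restrict R, ∀ i j, weakGrad R u x i j = 0) :
    u =ᵐ[volume.restrict R] 0 := by
  obtain ⟨f, hf, hfu, hfG, htr⟩ := exists_components hu
  have hcont {k : Plane → ℝ} (hk : Continuous k) : MemLp k 2 (volume.restrict R) :=
    memLp_box hk _ _ _ _
  have hx0 : ContDiff ℝ ∞ fun x : Plane => x 0 := contDiff_euclidean.1 contDiff_id 0
  have hd0 (x : Plane) : fderiv ℝ (fun x : Plane => x 0) x (e 0) = 1 := by
    rw [show (fun x : Plane => x 0) = (EuclideanSpace.proj 0 : Plane →L[ℝ] ℝ) from rfl,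
      ContinuousLinearMap.fderiv]
    simp
  have hcomp (i : Fin 2) : (fun x => u x i) =ᵐ[volume.restrict R] 0 := by
    have hu2 := hu.1.1 i
    have hfd (n) : Continuous fun x => fderiv ℝ (f i n) x (e 0) := continuous_partial (hf i n) _
    have hfc (n) : Continuous (f i n) := (hf i n).continuous
    have hG0 : Tendsto (fun n => eLpNorm (fun x => fderiv ℝ (f i n) x (e 0) - 0) 2
        (volume.restrict R)) atTop (𝓝 0) :=
      (hfG i 0).congr fun n => eLpNorm_congr_ae (hG.mono fun x hx => by simp only [hx])
    have hpair {g : Plane → ℝ} (hg : MemLp g 2 (volume.restrict R)) :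
        Tendsto (fun n => ∫ x in R, fderiv ℝ (f i n) x (e 0) * g x) atTop (𝓝 0) := by
      simpa using tendsto_integral_mul (fun n => hcont (hfd n)) (MemLp.zero' (α := Plane)) hg hG0
    have hxu : MemLp (fun x => x 0 * u x i) 2 (volume.restrict R) := by
      refine hu2.mono (hx0.continuous.aestronglyMeasurable.mul hu2.1)
        ((ae_restrict_mem isOpen_R.measurableSet).mono fun x hx => ?_)
      have : |x 0| ≤ 1 := abs_le.2 ⟨hx.1.1.le, by linarith [hx.1.2]⟩
      rw [norm_mul]
      exact mul_le_of_le_one_left (norm_nonneg _) this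
    -- integrate `∂₁ (x₁ f_n f_m)` over `R`
    have hid (n m : ℕ) : (∫ x in R, f i n x * f i m x) +
        (∫ x in R, fderiv ℝ (f i n) x (e 0) * (x 0 * f i m x)) +
        (∫ x in R, f i n x * (x 0 * fderiv ℝ (f i m) x (e 0))) =
        ∫ t in (-1 / 2 : ℝ)..(1 / 2), f i n !₂[-1, t] * f i m !₂[-1, t] := by
      have h1 : ContDiff ℝ ∞ fun x => x 0 * f i m x := hx0.mul (hf i m)
      have h := integral_box_partial_fst (((hf i n).mul h1).of_le (by simp))
        (by norm_num : (-1 : ℝ) ≤ 0) (by norm_num : (-1 / 2 : ℝ) ≤ 1 / 2)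
      -- The weight `x₁` is `0` on the right edge of `R`, where no boundary values are prescribed,
      -- and `-1` on the left edge.
      have hr : (∫ t in (-1 / 2 : ℝ)..(1 / 2), f i n !₂[0, t] * ((!₂[0, t] : Plane) 0 *
          f i m !₂[0, t])) - (∫ t in (-1 / 2 : ℝ)..(1 / 2), f i n !₂[-1, t] *
          ((!₂[-1, t] : Plane) 0 * f i m !₂[-1, t])) =
          ∫ t in (-1 / 2 : ℝ)..(1 / 2), f i n !₂[-1, t] * f i m !₂[-1, t] := by
        simp
      rw [← hr, ← h, ← integral_add, ← integral_add]
      · refine integral_congr_ae (.of_forall fun x => ?_)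
        simp only
        rw [fderiv_mul_apply (hf i n) h1, fderiv_mul_apply hx0 (hf i m), hd0]
        ring
      · exact ((hcont (hfc n)).integrable_mul (hcont (hfc m))).add
          ((hcont (hfd n)).integrable_mul (hcont h1.continuous))
      · exact (hcont (hfc n)).integrable_mul (hcont (hx0.continuous.mul (hfd m)))
      · exact (hcont (hfc n)).integrable_mul (hcont (hfc m))
      · exact (hcont (hfd n)).integrable_mul (hcont h1.continuous)
    -- Letting `n → ∞` at fixed `m` removes both the edge integral and the term with `∂₁ f_n`, since
    -- the trace on the left edge and the weak gradient vanish.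
    have hm (m : ℕ) : (∫ x in R, f i m x * u x i) +
        (∫ x in R, fderiv ℝ (f i m) x (e 0) * (x 0 * u x i)) = 0 := by
      have l1 := tendsto_integral_mul (fun n => hcont (hfc n)) hu2 (hcont (hfc m)) (hfu i)
      have l2 := hpair (hcont (hx0.continuous.mul (hfc m)))
      have l3 := tendsto_integral_mul (fun n => hcont (hfc n)) hu2
        (hcont (hx0.continuous.mul (hfd m))) (hfu i)
      have l4 := tendsto_intervalIntegral_trace (isometry_line_snd (-1))
        (by norm_num : (-1 / 2 : ℝ) ≤ 1 / 2) (fun t ht => left_mem_GammaD ht) hfc (htr i) (hfc m)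
      have h := tendsto_nhds_unique (((l1.add l2).add l3).congr fun n => hid n m) l4
      rw [add_zero] at h
      rw [← h]
      congr 1 <;> refine integral_congr_ae (.of_forall fun x => ?_) <;>
        simp only [Pi.mul_apply] <;> ring
    -- As `m → ∞` the remaining gradient term also vanishes, leaving `∫ uᵢ² = 0`.
    have l1 := tendsto_integral_mul (fun n => hcont (hfc n)) hu2 hu2 (hfu i)
    have h0 : ∫ x in R, u x i * u x i = 0 := by
      refine tendsto_nhds_unique (by simpa using l1.add (hpair hxu)) ?_
      exact tendsto_const_nhds.congr fun m => (hm m).symm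
    have h0' := (integral_eq_zero_iff_of_nonneg (fun x => mul_self_nonneg (u x i))
      (hu2.integrable_mul hu2)).1 h0
    exact h0'.mono fun x hx => mul_self_eq_zero.1 hx
  filter_upwards [hcomp 0, hcomp 1] with x h0 h1
  ext i; fin_cases i
  · exact h0
  · exact h1

end Insulation

/-! ### Minimality and uniqueness -/

theorem mainTheorem4 (M : ℝ) (hM0 : 0 < M) (hM4 : M ≤ 4)
    (u₀ : Insulation.Plane → Insulation.Plane) (hu₀ : Insulation.MemW12 Insulation.R u₀)
    (ψ : Insulation.Plane → Insulation.Plane) (hψ : ψ ∈ Insulation.admissible u₀)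
    (hEL : Insulation.IsWeakSolution M ψ) :
    IsMinOn (Insulation.energy M) (Insulation.admissible u₀) ψ ∧
      (M < 4 → ∀ v ∈ Insulation.admissible u₀,
        IsMinOn (Insulation.energy M) (Insulation.admissible u₀) v →
          v =ᵐ[volume.restrict Insulation.R] ψ) := by
  have hadd {v : Insulation.Plane → Insulation.Plane} (hv : v ∈ Insulation.admissible u₀) :
      Insulation.energy M v = Insulation.energy M ψ + Insulation.energy M (v - ψ) := by
    rw [← Insulation.energy_eq_add_of_isWeakSolution hψ.1 hEL
      (Insulation.sub_mem_admissible_zero hu₀ hψ hv), add_sub_cancel]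
  refine ⟨fun v hv => ?_, fun hM v hv hmin => ?_⟩
  · show Insulation.energy M ψ ≤ Insulation.energy M v
    have := Insulation.energy_nonneg hM0.le hM4 (Insulation.sub_mem_admissible_zero hu₀ hψ hv)
    linarith [hadd hv]
  · have hle : Insulation.energy M v ≤ Insulation.energy M ψ := hmin hψ
    have hu := Insulation.sub_mem_admissible_zero hu₀ hψ hv
    have hz := Insulation.ae_eq_zero_of_weakGrad hu
      (Insulation.weakGrad_ae_eq_zero hM0.le hM hu (by linarith [hadd hv]))
    exact hz.mono fun x hx => sub_eq_zero.1 hx
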